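/- Let $\mathcal F$ be a signature, $\mathcal V$ an infinite set of variables, and $\mathcal R$ a (possibly infinite) term rewrite system over $\mathcal F$ and $\mathcal V$; rules $l \to r$ are arbitrary pairs of terms ($l$ may be a variable, and $r$ may contain variables that are not in $l$). Call $\mathcal R$ linear if in both sides of every rule each variable occurs at most once. A rewrite step $s \to^{\pi} t$ has a redex pattern $\pi = \langle p, l\to r, \sigma\rangle$ with $l \to r \in \mathcal R$, $s|_p = l\sigma$ and $t = s[r\sigma]_p$. Given $i\colon \mathcal R \to \mathbb N$, the rule labeling $\ell^i$ labels a step $s \to^{\pi} t$, as well as its reverse reading $t \mathrel{{}^{\pi}{\leftarrow}} s$, by $i(l \to r)$; labels are compared by $>$ and $\geqslant$ on $\mathbb N$. Definitions. * A function $\ell$ on rewrite steps is a labeling if $\ell(s\to^\pi t) = \ell(t \mathrel{{}^{\pi}{\leftarrow}} s)$ and if, for all contexts $C$ and substitutions $\sigma$, $\ell(s \to^{\pi_1} t) \mathrel{\rhd} \ell(u \to^{\pi_2} v)$ implies $\ell(C[s\sigma] \to^{C[\pi_1\sigma]} C[t\sigma]) \mathrel{\rhd} \ell(C[u\sigma]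 \to^{C[\pi_2\sigma]} C[v\sigma])$, both for ${\rhd} = {>}$ and for ${\rhd} = {\geqslant}$. Here $C[\pi\sigma] = \langle qp, l\to r, \tau\sigma\rangle$ for $\pi = \langle p, l\to r,\tau\rangle$ and $q$ the position of the hole of $C$. * A local peak $t \mathrel{{}^{\pi_1}{\leftarrow}} s \to^{\pi_2} u$ whose two steps have labels $\alpha$ and $\beta$ is extended locally decreasing for $\ell$ if there are $t', t'', u'', u'$ with $t \leftrightarrow^* t' \to^{=} t'' \leftrightarrow^* u'' \mathrel{{}^{=}{\leftarrow}} u' \leftrightarrow^* u$ (where ${}^{=}$ means at most one step), such that every step label $\gamma$ in the five parts satisfies, respectively: $\alpha > \gamma$; $\beta \geqslant \gamma$; $\alpha > \gamma$ or $\beta > \gamma$; $\alpha \geqslant \gamma$; $\beta > \gamma$. * The local peak is a parallel peak if the positions $p_1, p_2$ of its steps are parallel, and a variable peak if $p_1 = p_2q'$ where $q'$ is not a function symbol position of the left-hand side $l_2$ of the rule of the right step. A labeling is compatible with $\mathcal R$ if all parallel peaks and all variable peaks of $\mathcal R$ are extended locally decreasing for it. * A critical peak of $\mathcal R$ is $l_2\mu[r_1\mu]_p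 \leftarrow l_2\mu \to r_2\mu$, where $l_1 \to r_1$ and $l_2 \to r_2$ are variants of rules of $\mathcal R$ without common variables, $p$ is a function symbol position of $l_2$, and $\mu$ is a most general unifier of $l_1$ and $l_2|_p$ (root overlaps of a rule with a variant of itself are included). Its steps use the rules of $\mathcal R$ of which the two are variants. Then, for every $i\colon \mathcal R \to \mathbb N$: 1. The rule labeling $\ell^i$ is a labeling. 2. If $\mathcal R$ is linear, then $\ell^i$ is compatible with $\mathcal R$. 3. If $\mathcal R$ is linear and all critical peaks of $\mathcal R$ are extended locally decreasing for $\ell^i$, then $\mathcal R$ is confluent, i.e. $s \to_{\mathcal R}^* t$ and $s \to_{\mathcal R}^* u$ imply that there is $v$ with $t \to_{\mathcal R}^* v$ and $u \to_{\mathcal R}^* v$. -/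

import Mathlib

namespace Rewriting

universe u v w

variable {L : FirstOrder.Language.{u, v}} {V : Type w}

/-! ### Terms

A signature is given by the function symbols (with arities) of a first-order language `L`; its
relation symbols play no role. `L.Term V` is the type of terms over this signature with variables
`V`. A substitution is a map `V → L.Term V`, applied by `Term.subst`. -/

/-- The number of occurrences of the variable `x` in a term. -/
noncomputable def occ (x : V) : L.Term V → ℕ
  | .var y => open Classical in if y = x then 1 else 0
  | .func _ ts => ∑ j, occ x (ts j)

/-- A term is linear if no variable occurs in it more than once. -/
def LinearTerm (t : L.Term V) : Prop := ∀ x, occ x t ≤ 1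

/-- The subterm of a term at a position, if the position exists in the term. Positions are finite
strings of argument indices, where the arguments of a function symbol are counted from `0`. -/
def subtermAt : L.Term V → List ℕ → Option (L.Term V)
  | t, [] => some t
  | .var _, _ :: _ => none
  | .func (l := n) _ ts, j :: q => if h : j < n then subtermAt (ts ⟨j, h⟩) q else none

/-- `replaceAt s p t` is `s[t]_p`, for a position `p` of `s` (for other `p` it is `s`). -/
def replaceAt : L.Term V → List ℕ → L.Term V → L.Term V
  | _, [], t => t
  | .var x, _ :: _, _ => .var x
  | .func (l := n) f ts, j :: q, t =>
      if h : j < n then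
        .func f (Function.update ts ⟨j, h⟩ (replaceAt (ts ⟨j, h⟩) q t))
      else .func f ts

/-- `p` is a function symbol position of `t`. -/
def IsFunPos (t : L.Term V) (p : List ℕ) : Prop :=
  ∃ s, subtermAt t p = some s ∧ ∀ x, s ≠ .var x

/-- Two positions are parallel if none is a prefix of the other. -/
def ParallelPos (p q : List ℕ) : Prop := ¬ p <+: q ∧ ¬ q <+: p

/-- Contexts. In `node f j ts C` the `j`-th argument of `f` is `C`, the others are given by `ts`
(the value `ts j` is ignored). -/
inductive Context (L : FirstOrder.Language.{u, v}) (V : Type w) : Type (max u w)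
  | hole : Context L V
  | node {n : ℕ} (f : L.Functions n) (j : Fin n) (ts : Fin n → L.Term V) (C : Context L V) :
      Context L V

/-- `C.fill t` is `C[t]`. -/
def Context.fill : Context L V → L.Term V → L.Term V
  | .hole, t => t
  | .node f j ts C, t => .func f (Function.update ts j (C.fill t))

/-- The position of the hole. -/
def Context.holePos : Context L V → List ℕ
  | .hole => []
  | .node _ j _ C => (j : ℕ) :: C.holePos

/-! ### Term rewrite systems -/

/-- A rewrite rule is an arbitrary pair of terms: the left-hand side may be a variable, and the
right-hand side may have variables that do not occur on the left. -/
structure Rule (L : FirstOrder.Language.{u, v}) (V : Type w) : Type (max u w) where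
  lhs : L.Term V
  rhs : L.Term V

/-- The variables of a rule. -/
def Rule.vars (ρ : Rule L V) : Set V := {x | 0 < occ x ρ.lhs ∨ 0 < occ x ρ.rhs}

/-- The variant of a rule obtained by renaming its variables. -/
def Rule.rename (e : Equiv.Perm V) (ρ : Rule L V) : Rule L V :=
  ⟨ρ.lhs.relabel e, ρ.rhs.relabel e⟩

/-- A term rewrite system: a (possibly infinite) set of rules. -/
abbrev TRS (L : FirstOrder.Language.{u, v}) (V : Type w) : Type (max u w) := Set (Rule L V)

/-- A TRS is linear if both sides of all its rules are linear. -/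
def LinearTRS (R : TRS L V) : Prop := ∀ ρ ∈ R, LinearTerm ρ.lhs ∧ LinearTerm ρ.rhs

/-- The rewrite relation of `R`: the smallest relation that contains `R` and is closed under
substitutions and contexts. -/
inductive Rewrites (R : TRS L V) : L.Term V → L.Term V → Prop
  | rule (ρ : Rule L V) (h : ρ ∈ R) : Rewrites R ρ.lhs ρ.rhs
  | subst (σ : V → L.Term V) {s t : L.Term V} (h : Rewrites R s t) :
      Rewrites R (s.subst σ) (t.subst σ)
  | context (C : Context L V) {s t : L.Term V} (h : Rewrites R s t) :
      Rewrites R (C.fill s) (C.fill t)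

/-- A TRS is confluent if `←* · →*` is contained in `→* · ←*`. -/
def Confluent (R : TRS L V) : Prop :=
  ∀ s t u : L.Term V, Relation.ReflTransGen (Rewrites R) s t →
    Relation.ReflTransGen (Rewrites R) s u →
    ∃ v, Relation.ReflTransGen (Rewrites R) t v ∧ Relation.ReflTransGen (Rewrites R) u v

/-- A rewrite step `s →^π t` of `R` with its redex pattern `π = ⟨p, l → r, σ⟩`. -/
structure Step (R : TRS L V) where
  source : L.Term V
  target : L.Term V
  pos : List ℕ
  rule : R
  subst : V → L.Term V
  source_at : subtermAt source pos = some (rule.1.lhs.subst subst)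
  target_eq : target = replaceAt source pos (rule.1.rhs.subst subst)

/-! ### Facts needed to close steps under contexts and substitutions -/

theorem subst_subst (t : L.Term V) (σ τ : V → L.Term V) :
    (t.subst σ).subst τ = t.subst (fun x => (σ x).subst τ) := by
  induction t with
  | var x => rfl
  | func f ts ih => simp only [FirstOrder.Language.Term.subst]; congr 1; funext j; exact ih j

theorem relabel_subst (t : L.Term V) (g : V → V) (σ : V → L.Term V) :
    (t.relabel g).subst σ = t.subst (fun x => σ (g x)) := by
  induction t with
  | var x => rfl
  | func f ts ih => simp only [FirstOrder.Language.Term.subst, FirstOrder.Language.Term.relabel]; congr 1; funext j; exact ih j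

theorem subtermAt_subst (σ : V → L.Term V) {s t : L.Term V} {p : List ℕ}
    (h : subtermAt s p = some t) : subtermAt (s.subst σ) p = some (t.subst σ) := by
  induction p generalizing s with
  | nil => simp only [subtermAt, Option.some.injEq] at h ⊢; rw [h]
  | cons j q ih =>
    cases s with
    | var x => simp [subtermAt] at h
    | @func n f ts =>
      by_cases hj : j < n
      · simp only [subtermAt, hj, dite_true, FirstOrder.Language.Term.subst] at h ⊢; exact ih h
      · simp [subtermAt, hj] at h

theorem replaceAt_subst (σ : V → L.Term V) {s t : L.Term V} {p : List ℕ}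
    (h : subtermAt s p = some t) (r : L.Term V) :
    (replaceAt s p r).subst σ = replaceAt (s.subst σ) p (r.subst σ) := by
  induction p generalizing s with
  | nil => simp only [replaceAt]
  | cons j q ih =>
    cases s with
    | var x => simp [subtermAt] at h
    | @func n f ts =>
      by_cases hj : j < n
      · simp only [subtermAt, hj, dite_true] at h
        simp only [replaceAt, hj, dite_true, FirstOrder.Language.Term.subst]
        congr 1
        funext k
        by_cases hk : k = ⟨j, hj⟩
        · subst hk; simp [ih h]
        · simp [Function.update_of_ne hk]
      · simp [subtermAt, hj] at h

theorem subtermAt_fill (C : Context L V) (t : L.Term V) (p : List ℕ) :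
    subtermAt (C.fill t) (C.holePos ++ p) = subtermAt t p := by
  induction C with
  | hole => rfl
  | node f j ts C ih => simp [Context.fill, Context.holePos, subtermAt, ih]

theorem replaceAt_fill (C : Context L V) (t r : L.Term V) (p : List ℕ) :
    replaceAt (C.fill t) (C.holePos ++ p) r = C.fill (replaceAt t p r) := by
  induction C with
  | hole => rfl
  | node f j ts C ih => simp [Context.fill, Context.holePos, replaceAt, ih]

/-- The step `C[sσ] → C[tσ]` with redex pattern `C[πσ] = ⟨qp, l → r, τσ⟩`, for a step `s → t` with
redex pattern `π = ⟨p, l → r, τ⟩` and the position `q` of the hole of `C`. -/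
def Step.inst {R : TRS L V} (C : Context L V) (σ : V → L.Term V) (a : Step R) : Step R where
  source := C.fill (a.source.subst σ)
  target := C.fill (a.target.subst σ)
  pos := C.holePos ++ a.pos
  rule := a.rule
  subst := fun x => (a.subst x).subst σ
  source_at := by
    rw [subtermAt_fill, subtermAt_subst σ a.source_at, subst_subst]
  target_eq := by
    rw [replaceAt_fill, a.target_eq, replaceAt_subst σ a.source_at, subst_subst]

/-! ### Conversions and labelings -/

/-- A rewrite step together with a direction: forward `s → t` or backward `t ← s`. -/
structure DirStep (R : TRS L V) where
  step : Step R
  forward : Bool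

/-- The step `s → t`, read from left to right. -/
def Step.fwd {R : TRS L V} (a : Step R) : DirStep R := ⟨a, true⟩

/-- The step `t ← s`, read from left to right. -/
def Step.bwd {R : TRS L V} (a : Step R) : DirStep R := ⟨a, false⟩

/-- The term on the left of a directed step. -/
def DirStep.start {R : TRS L V} (d : DirStep R) : L.Term V :=
  if d.forward then d.step.source else d.step.target

/-- The term on the right of a directed step. -/
def DirStep.finish {R : TRS L V} (d : DirStep R) : L.Term V :=
  if d.forward then d.step.target else d.step.source

/-- The list of directed steps is a conversion from `s` to `t`. -/
def IsConversion {R : TRS L V} : L.Term V → List (DirStep R) → L.Term V → Prop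
  | s, [], t => s = t
  | s, d :: c, t => d.start = s ∧ IsConversion d.finish c t

/-- The list is an optional forward step `s →⁼ t`. -/
def IsOptForward {R : TRS L V} (s : L.Term V) (c : List (DirStep R)) (t : L.Term V) : Prop :=
  IsConversion s c t ∧ c.length ≤ 1 ∧ ∀ d ∈ c, d.forward = true

/-- The list is an optional backward step `s ⁼← t`. -/
def IsOptBackward {R : TRS L V} (s : L.Term V) (c : List (DirStep R)) (t : L.Term V) : Prop :=
  IsConversion s c t ∧ c.length ≤ 1 ∧ ∀ d ∈ c, d.forward = false

/-- The labeling function `ℓ` on the (directed) steps of `R` is a labeling with respect to the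
relations `gt` and `ge` on labels. -/
structure IsLabeling {R : TRS L V} {Λ : Type*} (ℓ : DirStep R → Λ) (gt ge : Λ → Λ → Prop) :
    Prop where
  gt_inst : ∀ (C : Context L V) (σ : V → L.Term V) (a b : Step R),
    gt (ℓ a.fwd) (ℓ b.fwd) → gt (ℓ (a.inst C σ).fwd) (ℓ (b.inst C σ).fwd)
  ge_inst : ∀ (C : Context L V) (σ : V → L.Term V) (a b : Step R),
    ge (ℓ a.fwd) (ℓ b.fwd) → ge (ℓ (a.inst C σ).fwd) (ℓ (b.inst C σ).fwd)
  symm : ∀ a : Step R, ℓ a.fwd = ℓ a.bwd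

/-- The set of labels of a conversion. -/
def labels {R : TRS L V} {Λ : Type*} (ℓ : DirStep R → Λ) (c : List (DirStep R)) : Set Λ :=
  {β | ∃ d ∈ c, ℓ d = β}

/-- All labels `β` with `rel α β` for some `α ∈ S`. -/
def below {Λ : Type*} (rel : Λ → Λ → Prop) (S : Set Λ) : Set Λ := {β | ∃ α ∈ S, rel α β}

/-- The local peak `t ← s → u`, consisting of the steps `a : s → t` and `b : s → u` with a common
source, is extended locally decreasing: there is a local diagram
`t ↔* t' →⁼ t'' ↔* u'' ⁼← u' ↔* u` with suitable labels. -/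
def ExtLocDecreasing {R : TRS L V} {Λ : Type*} (ℓ : DirStep R → Λ) (gt ge : Λ → Λ → Prop)
    (a b : Step R) : Prop :=
  ∃ (t' t'' u'' u' : L.Term V) (c₁ c₂ c₃ c₄ c₅ : List (DirStep R)),
    IsConversion a.target c₁ t' ∧ IsOptForward t' c₂ t'' ∧ IsConversion t'' c₃ u'' ∧
    IsOptBackward u'' c₄ u' ∧ IsConversion u' c₅ b.target ∧
    labels ℓ c₁ ⊆ below gt {ℓ a.bwd} ∧
    labels ℓ c₂ ⊆ below ge {ℓ b.fwd} ∧
    labels ℓ c₃ ⊆ below gt {ℓ a.bwd, ℓ b.fwd} ∧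
    labels ℓ c₄ ⊆ below ge {ℓ a.bwd} ∧
    labels ℓ c₅ ⊆ below gt {ℓ b.fwd}

/-! ### Local peaks and critical peaks -/

/-- The steps `a : s → t` and `b : s → u` form a local peak `t ← s → u`. -/
def IsLocalPeak {R : TRS L V} (a b : Step R) : Prop := a.source = b.source

/-- A parallel peak: the two steps take place at parallel positions. -/
def IsParallelPeak {R : TRS L V} (a b : Step R) : Prop :=
  IsLocalPeak a b ∧ ParallelPos a.pos b.pos

/-- A variable peak: the position of `a` is that of `b` followed by some `q'` that is not a function
symbol position of the left-hand side of the rule of `b`. -/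
def IsVariablePeak {R : TRS L V} (a b : Step R) : Prop :=
  IsLocalPeak a b ∧ ∃ q', a.pos = b.pos ++ q' ∧ ¬ IsFunPos b.rule.1.lhs q'

/-- A labeling function is compatible with the TRS if it is a labeling and all parallel peaks and
all variable peaks are extended locally decreasing. -/
structure Compatible {R : TRS L V} {Λ : Type*} (ℓ : DirStep R → Λ) (gt ge : Λ → Λ → Prop) :
    Prop where
  labeling : IsLabeling ℓ gt ge
  parallel : ∀ a b : Step R, IsParallelPeak a b → ExtLocDecreasing ℓ gt ge a b
  variable_peak : ∀ a b : Step R, IsVariablePeak a b → ExtLocDecreasing ℓ gt ge a b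

/-- `μ` is a most general unifier of `s` and `t`. -/
def IsMGU (μ : V → L.Term V) (s t : L.Term V) : Prop :=
  s.subst μ = t.subst μ ∧
    ∀ τ : V → L.Term V, s.subst τ = t.subst τ → ∃ δ : V → L.Term V, ∀ x, τ x = (μ x).subst δ

/-- A critical overlap `(l₁ → r₁, p, l₂ → r₂)_μ` of `R`, where `l₁ → r₁` and `l₂ → r₂` are the
variants of rules `rule₁` and `rule₂` of `R` under the renamings `ren₁` and `ren₂`. Root overlaps of
a rule with a variant of itself are not excluded. -/
structure CriticalOverlap (R : TRS L V) where
  rule₁ : R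
  rule₂ : R
  ren₁ : Equiv.Perm V
  ren₂ : Equiv.Perm V
  apart : Disjoint (rule₁.1.rename ren₁).vars (rule₂.1.rename ren₂).vars
  pos : List ℕ
  funPos : IsFunPos (rule₂.1.rename ren₂).lhs pos
  mgu : V → L.Term V
  isMGU : ∀ s, subtermAt (rule₂.1.rename ren₂).lhs pos = some s →
    IsMGU mgu (rule₁.1.rename ren₁).lhs s

/-- The step `l₂μ → l₂μ[r₁μ]_p` of the critical peak of an overlap. It is a step with the rule
`rule₁` of `R`, of which `l₁ → r₁` is a variant. -/
def CriticalOverlap.inner {R : TRS L V} (o : CriticalOverlap R) : Step R where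
  source := (o.rule₂.1.rename o.ren₂).lhs.subst o.mgu
  target := replaceAt ((o.rule₂.1.rename o.ren₂).lhs.subst o.mgu) o.pos
    ((o.rule₁.1.rename o.ren₁).rhs.subst o.mgu)
  pos := o.pos
  rule := o.rule₁
  subst := fun x => o.mgu (o.ren₁ x)
  source_at := by
    obtain ⟨s, hs, -⟩ := o.funPos
    rw [subtermAt_subst o.mgu hs, ← (o.isMGU s hs).1]
    exact congrArg some (relabel_subst _ _ _)
  target_eq := by
    congr 1; exact relabel_subst _ _ _

/-- The step `l₂μ → r₂μ` of the critical peak of an overlap. -/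
def CriticalOverlap.outer {R : TRS L V} (o : CriticalOverlap R) : Step R where
  source := (o.rule₂.1.rename o.ren₂).lhs.subst o.mgu
  target := (o.rule₂.1.rename o.ren₂).rhs.subst o.mgu
  pos := []
  rule := o.rule₂
  subst := fun x => o.mgu (o.ren₂ x)
  source_at := by
    simp only [subtermAt]; exact congrArg some (relabel_subst _ _ _)
  target_eq := by
    simp only [replaceAt]; exact relabel_subst _ _ _

/-- All critical peaks `l₂μ[r₁μ]_p ← l₂μ → r₂μ` of the TRS are extended locally decreasing. -/
def CriticalPeaksDecreasing {R : TRS L V} {Λ : Type*} (ℓ : DirStep R → Λ)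
    (gt ge : Λ → Λ → Prop) : Prop :=
  ∀ o : CriticalOverlap R, ExtLocDecreasing ℓ gt ge o.inner o.outer

/-- The rule labeling for an index mapping `i` on the rules of `R`: a step is labeled by the index
of the rule it applies. -/
def ruleLabeling {R : TRS L V} (i : R → ℕ) : DirStep R → ℕ := fun d => i d.step.rule

end Rewriting

/-!
For a linear system, the steps of a parallel peak or a variable peak are joined by at most one
residual of each of them, and residuals use the same rules. A peak whose upper step lies at a
function symbol position of the lower left-hand side is an instance of a critical peak. Hence all
local peaks are extended locally decreasing.

That this implies confluence is the conversion version of decreasing diagrams. By well-founded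
induction on `k`, peaks of steps with labels at least `k` are decreasing even when their sources are
merely convertible by steps with labels below `k`: the largest label `j` in this conversion has the
diamond property modulo smaller steps, so the conversion can be replaced by a valley, along which
both steps of the peak are pushed down to a common term, modulo labels below `j`. In the same way a
conversion is replaced by a valley with smaller and smaller labels in the remaining gap.
-/

namespace Rewriting

/-! ### Decreasing diagrams with conversions -/

section DecreasingDiagrams

open Relation Set

variable {A : Type*} {Λ : Type*}

/-- Convertibility by steps with labels in `S`, for a family `r` of relations indexed by labels. -/
def Conv (r : Λ → A → A → Prop) (S : Set Λ) : A → A → Prop :=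
  EqvGen fun s t => ∃ n ∈ S, r n s t

/-- The terms `s` and `t` are connected by a decreasing diagram for a peak `s ← · → t` with the
labels `m` and `n`. In contrast to the valley version, conversions are allowed at all places. -/
def DecreasingJoin [Preorder Λ] (r : Λ → A → A → Prop) (m n : Λ) (s t : A) : Prop :=
  ∃ s' s'' t'' t', Conv r (Iio m) s s' ∧ ReflGen (r n) s' s'' ∧
    Conv r (Iio m ∪ Iio n) s'' t'' ∧ ReflGen (r m) t' t'' ∧ Conv r (Iio n) t' t

/-- The union of a family of relations. -/
def AnyStep (r : Λ → A → A → Prop) (s t : A) : Prop := ∃ n, r n s t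

variable {r : Λ → A → A → Prop}

namespace Conv

variable {S T : Set Λ} {s t u : A}

theorem refl (s : A) : Conv r S s s := EqvGen.refl s

theorem symm (h : Conv r S s t) : Conv r S t s := EqvGen.symm _ _ h

theorem trans (h₁ : Conv r S s t) (h₂ : Conv r S t u) : Conv r S s u := EqvGen.trans _ _ _ h₁ h₂

theorem of_step {n : Λ} (hn : n ∈ S) (h : r n s t) : Conv r S s t := EqvGen.rel _ _ ⟨n, hn, h⟩

theorem of_reflGen {n : Λ} (hn : n ∈ S) (h : ReflGen (r n) s t) : Conv r S s t := by
  rcases h with _ | h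
  · exact .refl s
  · exact .of_step hn h

theorem mono (hST : S ⊆ T) (h : Conv r S s t) : Conv r T s t :=
  EqvGen.mono (fun _ _ ⟨n, hn, hr⟩ => ⟨n, hST hn, hr⟩) _ _ h

theorem le_of_equivalence {E : A → A → Prop} (hE : Equivalence E)
    (hr : ∀ n ∈ S, ∀ s t, r n s t → E s t) (h : Conv r S s t) : E s t :=
  hE.eqvGen_iff.1 (EqvGen.mono (fun s t ⟨n, hn, h⟩ => hr n hn s t h) _ _ h)

theorem eq_or_exists_le [LinearOrder Λ] (h : Conv r S s t) :
    s = t ∨ ∃ j ∈ S, Conv r (Iic j) s t := by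
  induction h with
  | rel s t h =>
    obtain ⟨n, hn, h⟩ := h
    exact .inr ⟨n, hn, .of_step self_mem_Iic h⟩
  | refl s => exact .inl rfl
  | symm s t _ ih => exact ih.imp Eq.symm fun ⟨j, hj, h⟩ => ⟨j, hj, h.symm⟩
  | trans s t u _ _ ih₁ ih₂ =>
    rcases ih₁ with rfl | ⟨j, hj, h₁⟩
    · exact ih₂
    rcases ih₂ with rfl | ⟨k, hk, h₂⟩
    · exact .inr ⟨j, hj, h₁⟩
    rcases le_total j k with hjk | hkj
    · exact .inr ⟨k, hk, (h₁.mono (Iic_subset_Iic.2 hjk)).trans h₂⟩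
    · exact .inr ⟨j, hj, h₁.trans (h₂.mono (Iic_subset_Iic.2 hkj))⟩

theorem of_reflTransGen_anyStep (h : ReflTransGen (AnyStep r) s t) : Conv r univ s t := by
  induction h with
  | refl => exact .refl s
  | tail _ h ih => obtain ⟨n, h⟩ := h; exact ih.trans (.of_step (mem_univ n) h)

end Conv

theorem DecreasingJoin.symm [Preorder Λ] {m n : Λ} {s t : A} (h : DecreasingJoin r m n s t) :
    DecreasingJoin r n m t s := by
  obtain ⟨s', s'', t'', t', hs, hs', hst, ht', ht⟩ := h
  exact ⟨t', t'', s'', s', ht.symm, ht', union_comm (Iio m) _ ▸ hst.symm, hs', hs.symm⟩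

section LinearOrder

variable [LinearOrder Λ] {j k m n : Λ} {s s' t u v : A}

/-- Decreasingness modulo level `k`: peaks whose two steps have labels at least `k` and start from
terms that are convertible below `k` are decreasing. -/
def PeaksModuloDecreasing (r : Λ → A → A → Prop) (k : Λ) : Prop :=
  ∀ ⦃m n⦄, k ≤ m → k ≤ n → ∀ ⦃s s' t u⦄, r m s t → Conv r (Iio k) s s' → r n s' u →
    DecreasingJoin r m n t u

/-- At most one step with label `n`, modulo convertibility below `n`. -/
def OptStepModulo (r : Λ → A → A → Prop) (n : Λ) (s t : A) : Prop :=
  ∃ s' t', Conv r (Iio n) s s' ∧ ReflGen (r n) s' t' ∧ Conv r (Iio n) t' t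

namespace OptStepModulo

theorem of_step (h : r n s t) : OptStepModulo r n s t := ⟨s, t, .refl s, .single h, .refl t⟩

theorem of_conv (h : Conv r (Iio n) s t) : OptStepModulo r n s t := ⟨s, s, .refl s, .refl, h⟩

theorem conv_trans (h₁ : Conv r (Iio n) s t) (h₂ : OptStepModulo r n t u) :
    OptStepModulo r n s u := by
  obtain ⟨t', u', htt', h, hu⟩ := h₂
  exact ⟨t', u', h₁.trans htt', h, hu⟩

end OptStepModulo

namespace PeaksModuloDecreasing

theorem optStepModulo_diamond (hj : PeaksModuloDecreasing r j) (hst : OptStepModulo r j s t)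
    (hsu : OptStepModulo r j s u) :
    ∃ v, ReflGen (OptStepModulo r j) t v ∧ ReflTransGen (OptStepModulo r j) u v := by
  obtain ⟨s₁, t₁, hs₁, _ | hst', ht₁⟩ := id hst
  · exact ⟨u, .single (.conv_trans (hs₁.trans ht₁).symm hsu), .refl⟩
  obtain ⟨s₂, u₂, hs₂, _ | hsu', hu₂⟩ := id hsu
  · exact ⟨t, .refl, .single (.conv_trans (hs₂.trans hu₂).symm hst)⟩
  obtain ⟨t', v, v', u', ht', htv, hv, huv, hu'⟩ := hj le_rfl le_rfl hst' (hs₁.symm.trans hs₂) hsu'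
  rw [union_self] at hv
  exact ⟨v', .single ⟨t', v, ht₁.symm.trans ht', htv, hv⟩,
    .single ⟨u', v', (hu'.trans hu₂).symm, huv, .refl v'⟩⟩

theorem join_optStepModulo (hj : PeaksModuloDecreasing r j) (h : Conv r (Iic j) s t) :
    Join (ReflTransGen (OptStepModulo r j)) s t := by
  refine h.le_of_equivalence
    (equivalence_join_reflTransGen fun _ _ _ => hj.optStepModulo_diamond) fun n hn s t hst => ?_
  rcases (mem_Iic.1 hn).lt_or_eq with hn | rfl
  · exact ⟨t, .single (.of_conv (.of_step hn hst)), .refl⟩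
  · exact ⟨t, .single (.of_step hst), .refl⟩

theorem exists_residual (hj : PeaksModuloDecreasing r j) (hm : j < m) (hst : r m s t)
    (hsv : ReflTransGen (OptStepModulo r j) s v) :
    ∃ v' t', Conv r (Iio j) v v' ∧ ReflGen (r m) v' t' ∧ Conv r (Iio m) t' t := by
  have below : Iio j ⊆ Iio m := Iio_subset_Iio hm.le
  induction hsv with
  | refl => exact ⟨s, t, .refl s, .single hst, .refl t⟩
  | @tail v w _ hvw ih =>
    obtain ⟨v', t', hv', hvt', ht'⟩ := ih
    obtain ⟨v₁, w₁, hv₁, hvw₁, hw₁⟩ := hvw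
    rcases hvt' with _ | hvt'
    · have hwv : Conv r (Iio m) w v :=
        (hw₁.symm.mono below).trans <|
          (Conv.of_reflGen (mem_Iio.2 hm) hvw₁).symm.trans (hv₁.symm.mono below)
      exact ⟨w, w, .refl w, .refl, hwv.trans ((hv'.mono below).trans ht')⟩
    rcases hvw₁ with _ | hvw₁
    · exact ⟨v', t', (hw₁.symm.trans hv₁.symm).trans hv', .single hvt', ht'⟩
    obtain ⟨a, b, c, d, hta, hab, hbc, hdc, hdw⟩ := hj hm.le le_rfl hvt' (hv'.symm.trans hv₁) hvw₁
    rw [union_eq_self_of_subset_right below] at hbc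
    exact ⟨d, c, (hdw.trans hw₁).symm, hdc,
      (hta.trans ((Conv.of_reflGen (mem_Iio.2 hm) hab).trans hbc)).symm.trans ht'⟩

theorem decreasingJoin (hj : PeaksModuloDecreasing r j) (hm : j < m) (hn : j < n) (hst : r m s t)
    (hss' : Conv r (Iic j) s s') (hsu : r n s' u) : DecreasingJoin r m n t u := by
  obtain ⟨v, hsv, hsv'⟩ := hj.join_optStepModulo hss'
  obtain ⟨s₁, t₁, hs₁, hst₁, ht₁⟩ := hj.exists_residual hm hst hsv
  obtain ⟨s₂, u₂, hs₂, hsu₂, hu₂⟩ := hj.exists_residual hn hsu hsv'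
  have hs : Conv r (Iio j) s₁ s₂ := hs₁.symm.trans hs₂
  rcases hst₁ with _ | hst₁
  · exact ⟨s₂, u₂, u₂, u₂, ht₁.symm.trans (hs.mono (Iio_subset_Iio hm.le)), hsu₂, .refl u₂,
      .refl, hu₂⟩
  rcases hsu₂ with _ | hsu₂
  · exact ⟨t₁, t₁, t₁, s₁, ht₁.symm, .refl, .refl t₁, .single hst₁,
      (hs.mono (Iio_subset_Iio hn.le)).trans hu₂⟩
  obtain ⟨a, b, c, d, hta, hab, hbc, hdc, hdu⟩ := hj hm.le hn.le hst₁ hs hsu₂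
  exact ⟨a, b, c, d, ht₁.symm.trans hta, hab, hbc, hdc, hdu.trans hu₂⟩

end PeaksModuloDecreasing

theorem peaksModuloDecreasing [WellFoundedLT Λ]
    (hr : ∀ m n s t u, r m s t → r n s u → DecreasingJoin r m n t u) (k : Λ) :
    PeaksModuloDecreasing r k := by
  induction k using WellFoundedLT.induction with
  | ind k ih =>
    intro m n hm hn s s' t u hst hss' hsu
    rcases hss'.eq_or_exists_le with rfl | ⟨j, hj, hss'⟩
    · exact hr m n s t u hst hsu
    · exact (ih j hj).decreasingJoin (hj.trans_le hm) (hj.trans_le hn) hst hss' hsu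

/-- Lifting modulo level `k`: a step with a label `n ≥ k` from a term that is convertible to `s`
below `k` can be followed by rewriting from `s`, up to convertibility below `n`. -/
def StepsLiftModulo (r : Λ → A → A → Prop) (k : Λ) : Prop :=
  ∀ ⦃n⦄, k ≤ n → ∀ ⦃s s' u⦄, Conv r (Iio k) s s' → r n s' u →
    ∃ v, ReflTransGen (AnyStep r) s v ∧ Conv r (Iio n) v u

namespace StepsLiftModulo

theorem reflTransGen (hj : StepsLiftModulo r j) (h : ReflTransGen (OptStepModulo r j) s v) :
    ∃ v', ReflTransGen (AnyStep r) s v' ∧ Conv r (Iio j) v' v := by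
  induction h with
  | refl => exact ⟨s, .refl, .refl s⟩
  | tail _ hvw ih =>
    obtain ⟨v', hsv', hv'⟩ := ih
    obtain ⟨v₁, w₁, hv₁, hvw₁, hw₁⟩ := hvw
    rcases hvw₁ with _ | hvw₁
    · exact ⟨v', hsv', hv'.trans (hv₁.trans hw₁)⟩
    · obtain ⟨w', hw', hw'w₁⟩ := hj le_rfl (hv'.trans hv₁) hvw₁
      exact ⟨w', hsv'.trans hw', hw'w₁.trans hw₁⟩

theorem lift (hj : StepsLiftModulo r j) (hpeak : PeaksModuloDecreasing r j) (hn : j < n)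
    (hss' : Conv r (Iic j) s s') (hsu : r n s' u) :
    ∃ v, ReflTransGen (AnyStep r) s v ∧ Conv r (Iio n) v u := by
  obtain ⟨w, hsw, hsw'⟩ := hpeak.join_optStepModulo hss'
  obtain ⟨w', hw', hw'w⟩ := hj.reflTransGen hsw
  obtain ⟨w₁, u₁, hw₁, hwu₁, hu₁⟩ := hpeak.exists_residual hn hsu hsw'
  rcases hwu₁ with _ | hwu₁
  · exact ⟨w', hw', ((hw'w.trans hw₁).mono (Iio_subset_Iio hn.le)).trans hu₁⟩
  · obtain ⟨v, hv, hvu₁⟩ := hj hn.le (hw'w.trans hw₁) hwu₁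
    exact ⟨v, hw'.trans hv, hvu₁.trans hu₁⟩

end StepsLiftModulo

theorem stepsLiftModulo [WellFoundedLT Λ] (hr : ∀ k, PeaksModuloDecreasing r k) (k : Λ) :
    StepsLiftModulo r k := by
  induction k using WellFoundedLT.induction with
  | ind k ih =>
    intro n hn s s' u hss' hsu
    rcases hss'.eq_or_exists_le with rfl | ⟨j, hj, hss'⟩
    · exact ⟨u, .single ⟨n, hsu⟩, .refl u⟩
    · exact (ih j hj).lift (hr j) (hj.trans_le hn) hss' hsu

theorem Conv.join [WellFoundedLT Λ] (hr : ∀ k, PeaksModuloDecreasing r k) {k : Λ}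
    (h : Conv r (Iic k) s t) : Join (ReflTransGen (AnyStep r)) s t := by
  induction k using WellFoundedLT.induction generalizing s t with
  | ind k ih =>
    obtain ⟨v, hs, ht⟩ := (hr k).join_optStepModulo h
    obtain ⟨s', hs, hs'⟩ := (stepsLiftModulo hr k).reflTransGen hs
    obtain ⟨t', ht, ht'⟩ := (stepsLiftModulo hr k).reflTransGen ht
    rcases (hs'.trans ht'.symm).eq_or_exists_le with rfl | ⟨j, hj, hst⟩
    · exact ⟨s', hs, ht⟩
    · obtain ⟨w, hs'w, ht'w⟩ := ih j hj hst
      exact ⟨w, hs.trans hs'w, ht.trans ht'w⟩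

theorem churchRosser_of_decreasingJoin [WellFoundedLT Λ]
    (hr : ∀ m n s t u, r m s t → r n s u → DecreasingJoin r m n t u) (h : Conv r univ s t) :
    Join (ReflTransGen (AnyStep r)) s t := by
  rcases h.eq_or_exists_le with rfl | ⟨k, -, h⟩
  · exact ⟨s, .refl, .refl⟩
  · exact h.join (peaksModuloDecreasing hr)

end LinearOrder

section MapLabel

variable {Λ' : Type*} {s t u : A}

/-- The family obtained from `r` by renaming its labels along `f`. -/
def MapLabel (f : Λ → Λ') (r : Λ → A → A → Prop) (o : Λ') (s t : A) : Prop :=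
  ∃ n, f n = o ∧ r n s t

theorem anyStep_mapLabel (f : Λ → Λ') : AnyStep (MapLabel f r) = AnyStep r := by
  ext s t
  exact ⟨fun ⟨_, n, _, h⟩ => ⟨n, h⟩, fun ⟨n, h⟩ => ⟨f n, n, rfl, h⟩⟩

theorem DecreasingJoin.mapLabel [Preorder Λ] [Preorder Λ'] {f : Λ → Λ'} (hf : StrictMono f)
    {m n : Λ} (h : DecreasingJoin r m n s t) :
    DecreasingJoin (MapLabel f r) (f m) (f n) s t := by
  have step (n : Λ) : r n ≤ MapLabel f r (f n) := fun _ _ h => ⟨n, rfl, h⟩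
  have conv {S : Set Λ} {T : Set Λ'} (hST : MapsTo f S T) {s t : A} (h : Conv r S s t) :
      Conv (MapLabel f r) T s t :=
    EqvGen.mono (fun _ _ ⟨n, hn, h⟩ => ⟨f n, hST hn, step n _ _ h⟩) _ _ h
  have iio (k : Λ) : MapsTo f (Iio k) (Iio (f k)) := fun _ h => hf h
  obtain ⟨s', s'', t'', t', hs, hs', hst, ht', ht⟩ := h
  exact ⟨s', s'', t'', t', conv (iio m) hs, hs'.mono (step n),
    conv ((iio m).union_union (iio n)) hst, ht'.mono (step m), conv (iio n) ht⟩

theorem confluent_of_decreasingJoin [Preorder Λ] [WellFoundedLT Λ]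
    (hr : ∀ m n s t u, r m s t → r n s u → DecreasingJoin r m n t u)
    (hst : ReflTransGen (AnyStep r) s t) (hsu : ReflTransGen (AnyStep r) s u) :
    Join (ReflTransGen (AnyStep r)) t u := by
  -- Ranks make the labels linearly ordered, as needed to pick the largest label of a conversion.
  let rank : Λ → Ordinal := IsWellFounded.rank (· < ·)
  rw [← anyStep_mapLabel rank] at hst hsu ⊢
  refine churchRosser_of_decreasingJoin ?_ <|
    (Conv.of_reflTransGen_anyStep hst).symm.trans (.of_reflTransGen_anyStep hsu)
  rintro _ _ s t u ⟨m, rfl, hst⟩ ⟨n, rfl, hsu⟩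
  exact (hr m n s t u hst hsu).mapLabel WellFoundedLT.rank_strictMono

end MapLabel

end DecreasingDiagrams

universe u v w

variable {L : FirstOrder.Language.{u, v}} {V : Type w}

open FirstOrder.Language (Term)
open Set

/-! ### Terms, positions and contexts -/

theorem exists_context {s w : L.Term V} {p : List ℕ} (h : subtermAt s p = some w) :
    ∃ C : Context L V, C.holePos = p ∧ C.fill w = s := by
  induction p generalizing s with
  | nil => exact ⟨.hole, rfl, by simpa [subtermAt, Context.fill] using h.symm⟩
  | cons j q ih =>
    cases s with
    | var x => simp [subtermAt] at h
    | @func n f ts =>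
      by_cases hj : j < n
      · simp only [subtermAt, hj, dite_true] at h
        obtain ⟨C, hC, hw⟩ := ih h
        exact ⟨.node f ⟨j, hj⟩ ts C, by simp [Context.holePos, hC], by simp [Context.fill, hw]⟩
      · simp [subtermAt, hj] at h

theorem subtermAt_holePos (C : Context L V) (t : L.Term V) :
    subtermAt (C.fill t) C.holePos = some t := by
  simpa [subtermAt] using subtermAt_fill C t []

theorem replaceAt_holePos (C : Context L V) (t r : L.Term V) :
    replaceAt (C.fill t) C.holePos r = C.fill r := by
  simpa [replaceAt] using replaceAt_fill C t r []

section Positions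

variable {s t w : L.Term V} {p q : List ℕ}

theorem subtermAt_append (h : subtermAt s p = some w) (q : List ℕ) :
    subtermAt s (p ++ q) = subtermAt w q := by
  obtain ⟨C, rfl, rfl⟩ := exists_context h
  exact subtermAt_fill C w q

theorem replaceAt_append (h : subtermAt s p = some w) (q : List ℕ) (r : L.Term V) :
    replaceAt s (p ++ q) r = replaceAt s p (replaceAt w q r) := by
  obtain ⟨C, rfl, rfl⟩ := exists_context h
  rw [replaceAt_fill, replaceAt_holePos]

theorem ParallelPos.symm (h : ParallelPos p q) : ParallelPos q p := And.symm h

theorem ParallelPos.of_cons {j : ℕ} (h : ParallelPos (j :: p) (j :: q)) : ParallelPos p q := by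
  simpa only [ParallelPos, List.prefix_cons_inj] using h

theorem subtermAt_replaceAt_of_parallel (h : ParallelPos p q) (r : L.Term V) :
    subtermAt (replaceAt s p r) q = subtermAt s q := by
  induction s generalizing p q with
  | var x => cases p with
    | nil => exact absurd List.nil_prefix h.1
    | cons j p => rfl
  | @func n f ts ih =>
    match p, q, h with
    | [], _, h => exact absurd List.nil_prefix h.1
    | _, [], h => exact absurd List.nil_prefix h.2
    | j :: p, k :: q, h =>
      rcases eq_or_ne k j with rfl | hkj
      · by_cases hk : k < n <;> simp [replaceAt, subtermAt, hk, ih _ h.of_cons]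
      · by_cases hj : j < n <;> simp [replaceAt, subtermAt, hj, hkj, Function.update_of_ne]

theorem replaceAt_comm_of_parallel (h : ParallelPos p q) (r r' : L.Term V) :
    replaceAt (replaceAt s p r) q r' = replaceAt (replaceAt s q r') p r := by
  induction s generalizing p q with
  | var x => cases p <;> cases q <;> first | rfl | exact absurd h (by simp [ParallelPos])
  | @func n f ts ih =>
    match p, q, h with
    | [], _, h => exact absurd List.nil_prefix h.1
    | _, [], h => exact absurd List.nil_prefix h.2
    | j :: p, k :: q, h =>
      rcases eq_or_ne k j with rfl | hkj
      · by_cases hk : k < n <;> simp [replaceAt, hk, ih _ h.of_cons]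
      · by_cases hj : j < n <;> by_cases hk : k < n <;>
          simp [replaceAt, hj, hk, hkj, hkj.symm, Function.update_of_ne, Function.update_comm]

end Positions

/-! ### Substitutions and occurrences of variables -/

theorem subst_var (t : L.Term V) : t.subst Term.var = t := by
  induction t with
  | var x => rfl
  | func f ts ih => simp only [Term.subst, ih]

/-- The set of variables of a term. -/
def termVars (t : L.Term V) : Set V := {x | 0 < occ x t}

@[simp]
theorem termVars_var (x : V) : termVars (.var x : L.Term V) = {x} := by
  ext y
  by_cases h : x = y <;> simp [termVars, occ, h, Ne.symm]

@[simp]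
theorem termVars_func {n : ℕ} (f : L.Functions n) (ts : Fin n → L.Term V) :
    termVars (.func f ts) = ⋃ j, termVars (ts j) := by
  ext x
  simp [termVars, occ, Finset.sum_pos_iff]

theorem finite_termVars (t : L.Term V) : (termVars t).Finite := by
  induction t with
  | var x => simp
  | func f ts ih => simpa using finite_iUnion ih

theorem subst_congr {t : L.Term V} {σ τ : V → L.Term V} (h : EqOn σ τ (termVars t)) :
    t.subst σ = t.subst τ := by
  induction t with
  | var x => exact h (by simp)
  | func f ts ih =>
    have hj (j) : (ts j).subst σ = (ts j).subst τ :=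
      ih j (h.mono (termVars_func f ts ▸ subset_iUnion (fun j => termVars (ts j)) j))
    simp only [Term.subst, hj]

theorem occ_arg_le {n : ℕ} (f : L.Functions n) (ts : Fin n → L.Term V) (j : Fin n) (x : V) :
    occ x (ts j) ≤ occ x (.func f ts) :=
  Finset.single_le_sum (f := fun j => occ x (ts j)) (fun _ _ => Nat.zero_le _) (Finset.mem_univ j)

theorem LinearTerm.arg {n : ℕ} {f : L.Functions n} {ts : Fin n → L.Term V}
    (h : LinearTerm (.func f ts)) (j : Fin n) : LinearTerm (ts j) :=
  fun x => (occ_arg_le f ts j x).trans (h x)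

theorem eq_of_mem_termVars_arg {n : ℕ} {f : L.Functions n} {ts : Fin n → L.Term V} {x : V}
    (h : occ x (.func f ts) ≤ 1) {j k : Fin n} (hj : x ∈ termVars (ts j))
    (hk : x ∈ termVars (ts k)) : j = k := by
  by_contra hne
  have hle : ∑ i ∈ {j, k}, occ x (ts i) ≤ occ x (.func f ts) :=
    Finset.sum_le_sum_of_subset (Finset.subset_univ _)
  rw [Finset.sum_pair hne] at hle
  exact absurd (hle.trans h) (by have : 0 < _ := hj; have : 0 < _ := hk; omega)

theorem LinearTerm.pairwise_disjoint_termVars {n : ℕ} {f : L.Functions n} {ts : Fin n → L.Term V}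
    (h : LinearTerm (.func f ts)) : Pairwise (Function.onFun Disjoint fun j => termVars (ts j)) :=
  fun _ _ hjk => disjoint_left.2 fun x hj hk => hjk (eq_of_mem_termVars_arg (h x) hj hk)

theorem occ_le_occ_fill (C : Context L V) (t : L.Term V) (x : V) : occ x t ≤ occ x (C.fill t) := by
  induction C with
  | hole => exact le_rfl
  | node f j ts C ih =>
    have h := occ_arg_le f (Function.update ts j (C.fill t)) j x
    rw [Function.update_self] at h
    exact ih.trans h

section Subterms

variable {s t : L.Term V} {p : List ℕ}

theorem occ_le_of_subtermAt (h : subtermAt s p = some t) (x : V) : occ x t ≤ occ x s := by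
  obtain ⟨C, -, rfl⟩ := exists_context h
  exact occ_le_occ_fill C t x

theorem termVars_subset_of_subtermAt (h : subtermAt s p = some t) : termVars t ⊆ termVars s :=
  fun x hx => hx.trans_le (occ_le_of_subtermAt h x)

theorem LinearTerm.subtermAt (hs : LinearTerm s) (h : subtermAt s p = some t) : LinearTerm t :=
  fun x => (occ_le_of_subtermAt h x).trans (hs x)

end Subterms

theorem exists_subtermAt_eq_var {x : V} {t : L.Term V} (h : x ∈ termVars t) :
    ∃ p, subtermAt t p = some (.var x) := by
  induction t with
  | var y =>
    obtain rfl : x = y := by simpa using h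
    exact ⟨[], rfl⟩
  | func f ts ih =>
    obtain ⟨j, hj⟩ := mem_iUnion.1 (termVars_func f ts ▸ h)
    obtain ⟨p, hp⟩ := ih j hj
    exact ⟨j :: p, by simpa [subtermAt] using hp⟩

theorem replaceAt_subst_of_occ_le_one [DecidableEq V] {t : L.Term V} {x : V} {p : List ℕ}
    (ht : occ x t ≤ 1) (hp : subtermAt t p = some (.var x)) (σ : V → L.Term V) (r : L.Term V) :
    replaceAt (t.subst σ) p r = t.subst (Function.update σ x r) := by
  obtain ⟨C, rfl, rfl⟩ := exists_context hp
  clear hp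
  induction C with
  | hole => simp [Context.fill, Context.holePos, replaceAt, Term.subst]
  | node f j ts C ih =>
    simp only [Context.fill, Context.holePos, Term.subst, replaceAt, Fin.is_lt, dite_true,
      Fin.eta, Term.func.injEq, heq_eq_eq, true_and] at ht ⊢
    have hj := occ_arg_le f (Function.update ts j (C.fill (.var x))) j x
    have hx : x ∈ termVars (Function.update ts j (C.fill (.var x)) j) := by
      rw [Function.update_self]
      exact (by simp : x ∈ termVars (.var x)).trans_le (occ_le_occ_fill C (.var x) x)
    funext k
    rcases eq_or_ne k j with rfl | hkj
    · simp only [Function.update_self] at hj ⊢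
      exact ih (hj.trans ht)
    · rw [Function.update_of_ne hkj]
      refine subst_congr fun y hy => (Function.update_of_ne ?_ _ _).symm
      rintro rfl
      exact hkj (eq_of_mem_termVars_arg ht hy hx)

theorem exists_var_of_not_isFunPos {t w : L.Term V} {σ : V → L.Term V} {p : List ℕ}
    (hp : ¬ IsFunPos t p) (h : subtermAt (t.subst σ) p = some w) :
    ∃ x p₁ p₂, p = p₁ ++ p₂ ∧ subtermAt t p₁ = some (.var x) ∧
      subtermAt (σ x) p₂ = some w := by
  induction p generalizing t with
  | nil =>
    cases t with
    | var x => exact ⟨x, [], [], rfl, rfl, h⟩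
    | func f ts => exact absurd ⟨_, rfl, fun x => by simp⟩ hp
  | cons j q ih =>
    cases t with
    | var x => exact ⟨x, [], j :: q, rfl, rfl, h⟩
    | @func n f ts =>
      by_cases hj : j < n
      · simp only [Term.subst, subtermAt, hj, dite_true] at h
        have hq : ¬ IsFunPos (ts ⟨j, hj⟩) q := by
          simpa [IsFunPos, subtermAt, hj] using hp
        obtain ⟨x, p₁, p₂, rfl, h₁, h₂⟩ := ih hq h
        exact ⟨x, j :: p₁, p₂, rfl, by simpa [subtermAt, hj] using h₁, h₂⟩
      · simp [Term.subst, subtermAt, hj] at h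

/-! ### Rewrite steps and conversions -/

/-- The step `C[lσ] → C[rσ]` at the hole of `C`, for a rule `l → r`. -/
def Step.ofContext {R : TRS L V} (C : Context L V) (ρ : R) (σ : V → L.Term V) : Step R where
  source := C.fill (ρ.1.lhs.subst σ)
  target := C.fill (ρ.1.rhs.subst σ)
  pos := C.holePos
  rule := ρ
  subst := σ
  source_at := subtermAt_holePos C _
  target_eq := (replaceAt_holePos C _ _).symm

theorem Step.exists_eq_ofContext {R : TRS L V} (a : Step R) :
    ∃ C, a = .ofContext C a.rule a.subst := by
  obtain ⟨s, t, p, ρ, σ, hs, rfl⟩ := a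
  obtain ⟨C, rfl, rfl⟩ := exists_context hs
  exact ⟨C, by simp only [ofContext, replaceAt_holePos]⟩

theorem rewrites_iff_exists_step {R : TRS L V} {s t : L.Term V} :
    Rewrites R s t ↔ ∃ a : Step R, a.source = s ∧ a.target = t := by
  constructor
  · intro h
    induction h with
    | rule ρ h => exact ⟨.ofContext .hole ⟨ρ, h⟩ .var, subst_var _, subst_var _⟩
    | subst σ _ ih =>
      obtain ⟨a, rfl, rfl⟩ := ih
      exact ⟨a.inst .hole σ, rfl, rfl⟩
    | context C _ ih =>
      obtain ⟨a, rfl, rfl⟩ := ih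
      exact ⟨a.inst C .var, congrArg C.fill (subst_var _), congrArg C.fill (subst_var _)⟩
  · rintro ⟨a, rfl, rfl⟩
    obtain ⟨C, ha⟩ := a.exists_eq_ofContext
    rw [ha]
    exact .context C (.subst _ (.rule _ a.rule.2))

theorem Step.isOptForward {R : TRS L V} (a : Step R) : IsOptForward a.source [a.fwd] a.target :=
  ⟨⟨rfl, rfl⟩, le_rfl, by simp [Step.fwd]⟩

theorem Step.isOptBackward {R : TRS L V} (a : Step R) :
    IsOptBackward a.target [a.bwd] a.source :=
  ⟨⟨rfl, rfl⟩, le_rfl, by simp [Step.bwd]⟩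

/-! ### Extended local decreasingness -/

section ExtLocDecreasing

variable {R : TRS L V} {Λ : Type*} {ℓ : DirStep R → Λ} {gt ge : Λ → Λ → Prop}
  {a b a' b' : Step R}

theorem labels_subset_below_singleton {rel : Λ → Λ → Prop} {α : Λ} {c : List (DirStep R)} :
    labels ℓ c ⊆ below rel {α} ↔ ∀ d ∈ c, rel α (ℓ d) := by
  simp [labels, below, subset_def]

theorem labels_subset_below_pair {rel : Λ → Λ → Prop} {α β : Λ} {c : List (DirStep R)} :
    labels ℓ c ⊆ below rel {α, β} ↔ ∀ d ∈ c, rel α (ℓ d) ∨ rel β (ℓ d) := by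
  simp [labels, below, subset_def]

theorem ExtLocDecreasing.of_opt {v : L.Term V} {c c' : List (DirStep R)}
    (hc : IsOptForward a.target c v) (hcb : ∀ d ∈ c, ge (ℓ b.fwd) (ℓ d))
    (hc' : IsOptBackward v c' b.target) (hca : ∀ d ∈ c', ge (ℓ a.bwd) (ℓ d)) :
    ExtLocDecreasing ℓ gt ge a b := by
  refine ⟨a.target, v, v, b.target, [], c, [], c', [], rfl, hc, rfl, hc', rfl, ?_⟩
  simp only [labels_subset_below_singleton, labels_subset_below_pair]
  exact ⟨by simp, hcb, by simp, hca, by simp⟩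

theorem ExtLocDecreasing.congr (h : ExtLocDecreasing ℓ gt ge a b)
    (hat : a.target = a'.target) (hbt : b.target = b'.target)
    (ha : ℓ a.bwd = ℓ a'.bwd) (hb : ℓ b.fwd = ℓ b'.fwd) : ExtLocDecreasing ℓ gt ge a' b' := by
  unfold ExtLocDecreasing at h ⊢
  rwa [← hat, ← hbt, ← ha, ← hb]

/-- Closure of directed steps under contexts and substitutions. -/
def DirStep.inst (C : Context L V) (σ : V → L.Term V) (d : DirStep R) : DirStep R :=
  ⟨d.step.inst C σ, d.forward⟩

theorem IsConversion.inst {s t : L.Term V} {c : List (DirStep R)} (h : IsConversion s c t)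
    (C : Context L V) (σ : V → L.Term V) :
    IsConversion (C.fill (s.subst σ)) (c.map (.inst C σ)) (C.fill (t.subst σ)) := by
  induction c generalizing s with
  | nil => exact congrArg (fun t => C.fill (t.subst σ)) h
  | cons d c ih =>
    obtain ⟨⟨a, fwd⟩, rfl, h⟩ := d, h
    cases fwd <;> exact ⟨rfl, ih h⟩

theorem IsOptForward.inst {s t : L.Term V} {c : List (DirStep R)} (h : IsOptForward s c t)
    (C : Context L V) (σ : V → L.Term V) :
    IsOptForward (C.fill (s.subst σ)) (c.map (.inst C σ)) (C.fill (t.subst σ)) :=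
  ⟨h.1.inst C σ, by simpa using h.2.1, by simpa [DirStep.inst] using h.2.2⟩

theorem IsOptBackward.inst {s t : L.Term V} {c : List (DirStep R)} (h : IsOptBackward s c t)
    (C : Context L V) (σ : V → L.Term V) :
    IsOptBackward (C.fill (s.subst σ)) (c.map (.inst C σ)) (C.fill (t.subst σ)) :=
  ⟨h.1.inst C σ, by simpa using h.2.1, by simpa [DirStep.inst] using h.2.2⟩

theorem IsLabeling.apply_eq_fwd (hℓ : IsLabeling ℓ gt ge) (d : DirStep R) : ℓ d = ℓ d.step.fwd := by
  obtain ⟨a, _ | _⟩ := d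
  · exact (hℓ.symm a).symm
  · rfl

theorem IsLabeling.gt_dirStep_inst (hℓ : IsLabeling ℓ gt ge) (C : Context L V) (σ : V → L.Term V)
    {d e : DirStep R} (h : gt (ℓ d) (ℓ e)) : gt (ℓ (d.inst C σ)) (ℓ (e.inst C σ)) := by
  rw [hℓ.apply_eq_fwd d, hℓ.apply_eq_fwd e] at h
  rw [hℓ.apply_eq_fwd (d.inst C σ), hℓ.apply_eq_fwd (e.inst C σ)]
  exact hℓ.gt_inst C σ _ _ h

theorem IsLabeling.ge_dirStep_inst (hℓ : IsLabeling ℓ gt ge) (C : Context L V) (σ : V → L.Term V)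
    {d e : DirStep R} (h : ge (ℓ d) (ℓ e)) : ge (ℓ (d.inst C σ)) (ℓ (e.inst C σ)) := by
  rw [hℓ.apply_eq_fwd d, hℓ.apply_eq_fwd e] at h
  rw [hℓ.apply_eq_fwd (d.inst C σ), hℓ.apply_eq_fwd (e.inst C σ)]
  exact hℓ.ge_inst C σ _ _ h

theorem ExtLocDecreasing.inst (hℓ : IsLabeling ℓ gt ge) (h : ExtLocDecreasing ℓ gt ge a b)
    (C : Context L V) (σ : V → L.Term V) :
    ExtLocDecreasing ℓ gt ge (a.inst C σ) (b.inst C σ) := by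
  obtain ⟨t', t'', u'', u', c₁, c₂, c₃, c₄, c₅, h₁, h₂, h₃, h₄, h₅, l⟩ := h
  refine ⟨_, _, _, _, _, _, _, _, _, h₁.inst C σ, h₂.inst C σ, h₃.inst C σ, h₄.inst C σ,
    h₅.inst C σ, ?_⟩
  simp only [labels_subset_below_singleton, labels_subset_below_pair, List.forall_mem_map] at l ⊢
  exact ⟨fun d hd => hℓ.gt_dirStep_inst C σ (l.1 d hd),
    fun d hd => hℓ.ge_dirStep_inst C σ (l.2.1 d hd),
    fun d hd => (l.2.2.1 d hd).imp (hℓ.gt_dirStep_inst C σ) (hℓ.gt_dirStep_inst C σ),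
    fun d hd => hℓ.ge_dirStep_inst C σ (l.2.2.2.1 d hd),
    fun d hd => hℓ.gt_dirStep_inst C σ (l.2.2.2.2 d hd)⟩

end ExtLocDecreasing

/-! ### Rule labelings -/

section RuleLabeling

variable {R : TRS L V} {Λ : Type*} {a b : Step R}

/-- The rule labeling for an index mapping with values in an arbitrary type of labels. -/
def generalRuleLabeling (i : R → Λ) : DirStep R → Λ := fun d => i d.step.rule

theorem isLabeling_generalRuleLabeling (i : R → Λ) (gt ge : Λ → Λ → Prop) :
    IsLabeling (generalRuleLabeling i) gt ge :=
  ⟨fun _ _ _ _ h => h, fun _ _ _ _ h => h, fun _ => rfl⟩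

theorem ExtLocDecreasing.generalRuleLabeling_of_opt [Preorder Λ] {v : L.Term V}
    {c c' : List (DirStep R)}
    (hc : IsOptForward a.target c v) (hcb : ∀ d ∈ c, d.step.rule = b.rule)
    (hc' : IsOptBackward v c' b.target) (hca : ∀ d ∈ c', d.step.rule = a.rule) (i : R → Λ) :
    ExtLocDecreasing (generalRuleLabeling i) (· > ·) (· ≥ ·) a b :=
  .of_opt hc (fun d hd => (congrArg i (hcb d hd)).le) hc' fun d hd => (congrArg i (hca d hd)).le

theorem IsParallelPeak.symm (h : IsParallelPeak a b) : IsParallelPeak b a :=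
  ⟨h.1.symm, h.2.symm⟩

theorem IsParallelPeak.exists_residual (h : IsParallelPeak a b) :
    ∃ b' : Step R, b'.rule = b.rule ∧ b'.source = a.target ∧
      b'.target = replaceAt a.target b.pos (b.rule.1.rhs.subst b.subst) := by
  have hb : subtermAt a.target b.pos = some (b.rule.1.lhs.subst b.subst) := by
    rw [a.target_eq, subtermAt_replaceAt_of_parallel h.2, h.1, b.source_at]
  exact ⟨⟨a.target, _, b.pos, b.rule, b.subst, hb, rfl⟩, rfl, rfl, rfl⟩

theorem IsParallelPeak.extLocDecreasing [Preorder Λ] (h : IsParallelPeak a b) (i : R → Λ) :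
    ExtLocDecreasing (generalRuleLabeling i) (· > ·) (· ≥ ·) a b := by
  obtain ⟨b', hb', hbs, hbt⟩ := h.exists_residual
  obtain ⟨a', ha', has, hat⟩ := h.symm.exists_residual
  have htarget : a'.target = b'.target := by
    rw [hat, hbt, a.target_eq, b.target_eq, h.1, replaceAt_comm_of_parallel h.2]
  exact .generalRuleLabeling_of_opt (hbs ▸ b'.isOptForward) (by simpa [Step.fwd] using hb')
    (has ▸ htarget ▸ a'.isOptBackward) (by simpa [Step.bwd] using ha') i

theorem exists_isOptBackward_subst_update [DecidableEq V] {t : L.Term V} {x : V}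
    (ht : occ x t ≤ 1) (C : Context L V) {σ τ : V → L.Term V} {p : List ℕ} {ρ : R}
    (hσ : subtermAt (σ x) p = some (ρ.1.lhs.subst τ)) :
    ∃ c : List (DirStep R), (∀ d ∈ c, d.step.rule = ρ) ∧
      IsOptBackward
        (C.fill (t.subst (Function.update σ x (replaceAt (σ x) p (ρ.1.rhs.subst τ))))) c
        (C.fill (t.subst σ)) := by
  by_cases hx : x ∈ termVars t
  · obtain ⟨q, hq⟩ := exists_subtermAt_eq_var hx
    have hqσ : subtermAt (t.subst σ) q = some (σ x) := subtermAt_subst σ hq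
    let a : Step R := ⟨C.fill (t.subst σ), _, C.holePos ++ (q ++ p), ρ, τ, by
      rw [subtermAt_fill, subtermAt_append hqσ, hσ], rfl⟩
    have hat : a.target = C.fill (t.subst (Function.update σ x (replaceAt (σ x) p
        (ρ.1.rhs.subst τ)))) := by
      rw [a.target_eq, replaceAt_fill, replaceAt_append hqσ, replaceAt_subst_of_occ_le_one ht hq]
    exact ⟨[a.bwd], by simp [Step.bwd, a], hat ▸ a.isOptBackward⟩
  · refine ⟨[], by simp, ?_, by simp, by simp⟩
    refine congrArg C.fill (subst_congr fun y hy => Function.update_of_ne ?_ _ _)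
    exact fun hyx => hx (hyx ▸ hy)

theorem IsVariablePeak.extLocDecreasing [Preorder Λ] (h : IsVariablePeak a b)
    (hl : LinearTerm b.rule.1.lhs) (hr : LinearTerm b.rule.1.rhs) (i : R → Λ) :
    ExtLocDecreasing (generalRuleLabeling i) (· > ·) (· ≥ ·) a b := by
  classical
  obtain ⟨hs, q, hq, hfun⟩ := h
  have ha := a.source_at
  rw [hs, hq, subtermAt_append b.source_at] at ha
  obtain ⟨x, p₁, p₂, rfl, hp₁, hp₂⟩ := exists_var_of_not_isFunPos hfun ha
  have hp₁σ : subtermAt (b.rule.1.lhs.subst b.subst) p₁ = some (b.subst x) :=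
    subtermAt_subst b.subst hp₁
  obtain ⟨C, hb⟩ := b.exists_eq_ofContext
  have hbs : b.source = C.fill (b.rule.1.lhs.subst b.subst) := congrArg Step.source hb
  have hbt : b.target = C.fill (b.rule.1.rhs.subst b.subst) := congrArg Step.target hb
  have hbp : b.pos = C.holePos := congrArg Step.pos hb
  let b' : Step R := .ofContext C b.rule
    (Function.update b.subst x (replaceAt (b.subst x) p₂ (a.rule.1.rhs.subst a.subst)))
  have hb' : b'.source = a.target := by
    rw [a.target_eq, hs, hq, hbs, hbp, replaceAt_fill, replaceAt_append hp₁σ,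
      replaceAt_subst_of_occ_le_one (hl x) hp₁]
    rfl
  obtain ⟨c, hc, hopt⟩ := exists_isOptBackward_subst_update (hr x) C hp₂
  exact .generalRuleLabeling_of_opt (hb' ▸ b'.isOptForward) (by simp [Step.fwd, b', Step.ofContext])
    (hbt ▸ hopt) hc i

end RuleLabeling

theorem LinearTRS.compatible_generalRuleLabeling {R : TRS L V} {Λ : Type*} [Preorder Λ]
    (hR : LinearTRS R) (i : R → Λ) : Compatible (generalRuleLabeling i) (· > ·) (· ≥ ·) :=
  ⟨isLabeling_generalRuleLabeling i _ _, fun _ _ h => h.extLocDecreasing i,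
    fun _ b h => h.extLocDecreasing (hR _ b.rule.2).1 (hR _ b.rule.2).2 i⟩

/-! ### Unification -/

theorem exists_eqOn_of_pairwise_disjoint {ι α β : Type*} {S : ι → Set α}
    (hS : Pairwise (Function.onFun Disjoint S)) (f : ι → α → β) (g : α → β) :
    ∃ h : α → β, (∀ j, EqOn h (f j) (S j)) ∧ EqOn h g (⋃ j, S j)ᶜ := by
  classical
  refine ⟨fun x => if hx : ∃ j, x ∈ S j then f hx.choose x else g x, fun j x hx => ?_,
    fun x hx => dif_neg (by simpa using hx)⟩
  have hex : ∃ j, x ∈ S j := ⟨j, hx⟩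
  have hj : hex.choose = j := by
    by_contra hne
    exact disjoint_left.1 (hS hne) hex.choose_spec hx
  simp only [dif_pos hex, hj]

/-- An idempotent most general unifier of `s` and `t`. Every unifier `θ` is required to factor
through `μ` by `θ` itself, which includes the idempotence of `μ`. -/
def IsIdempotentMGU (μ : V → L.Term V) (s t : L.Term V) : Prop :=
  s.subst μ = t.subst μ ∧
    ∀ θ : V → L.Term V, s.subst θ = t.subst θ → ∀ x, (μ x).subst θ = θ x

namespace IsIdempotentMGU

theorem isMGU {μ : V → L.Term V} {s t : L.Term V} (h : IsIdempotentMGU μ s t) : IsMGU μ s t :=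
  ⟨h.1, fun θ hθ => ⟨θ, fun x => (h.2 θ hθ x).symm⟩⟩

theorem symm {μ : V → L.Term V} {s t : L.Term V} (h : IsIdempotentMGU μ s t) :
    IsIdempotentMGU μ t s :=
  ⟨h.1.symm, fun θ hθ => h.2 θ hθ.symm⟩

theorem update_var [DecidableEq V] {y : V} {t : L.Term V} (hy : y ∉ termVars t) :
    IsIdempotentMGU (Function.update Term.var y t) (.var y) t := by
  refine ⟨?_, fun θ hθ x => ?_⟩
  · have ht : t.subst (Function.update Term.var y t) = t.subst Term.var :=
      subst_congr fun x hx => Function.update_of_ne (by rintro rfl; exact hy hx) _ _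
    rw [ht, subst_var, Term.subst, Function.update_self]
  · rcases eq_or_ne x y with rfl | hxy
    · rw [Function.update_self]
      exact hθ.symm
    · rw [Function.update_of_ne hxy]
      rfl

theorem exists_func {n : ℕ} (f : L.Functions n) {ss ts : Fin n → L.Term V}
    (hd : Pairwise (Function.onFun Disjoint fun j => termVars (ss j) ∪ termVars (ts j)))
    (h : ∀ j, ∃ μ, IsIdempotentMGU μ (ss j) (ts j)) :
    ∃ μ, IsIdempotentMGU μ (.func f ss) (.func f ts) := by
  choose μ hμ using h
  obtain ⟨ν, hν, hν'⟩ := exists_eqOn_of_pairwise_disjoint hd μ Term.var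
  refine ⟨ν, ?_, fun θ hθ x => ?_⟩
  · simp only [Term.subst, Term.func.injEq, heq_eq_eq, true_and]
    funext j
    rw [subst_congr ((hν j).mono subset_union_left), (hμ j).1,
      subst_congr ((hν j).mono subset_union_right)]
  · by_cases hx : x ∈ ⋃ j, termVars (ss j) ∪ termVars (ts j)
    · obtain ⟨j, hj⟩ := mem_iUnion.1 hx
      simp only [Term.subst, Term.func.injEq, heq_eq_eq, true_and] at hθ
      rw [hν j hj, (hμ j).2 θ (congrFun hθ j)]
    · rw [hν' hx]
      rfl

end IsIdempotentMGU

theorem LinearTerm.exists_isIdempotentMGU {s t : L.Term V} (hs : LinearTerm s) (ht : LinearTerm t)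
    (hd : Disjoint (termVars s) (termVars t)) {τ : V → L.Term V} (h : s.subst τ = t.subst τ) :
    ∃ μ, IsIdempotentMGU μ s t := by
  classical
  induction s generalizing t with
  | var y => exact ⟨_, .update_var (by simpa using hd)⟩
  | @func n f ss ih =>
    cases t with
    | var y => exact ⟨_, (IsIdempotentMGU.update_var (by simpa using hd)).symm⟩
    | @func m g ts =>
      simp only [Term.subst, Term.func.injEq] at h
      obtain ⟨rfl, hfg, hargs⟩ := h
      obtain rfl := eq_of_heq hfg
      have hdj (j k) : Disjoint (termVars (ss j)) (termVars (ts k)) := by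
        simp only [termVars_func, disjoint_iUnion_left, disjoint_iUnion_right] at hd
        exact hd k j
      refine IsIdempotentMGU.exists_func f (fun j k hjk => ?_) fun j =>
        ih j (hs.arg j) (ht.arg j) (hdj j j) (congrFun (eq_of_heq hargs) j)
      exact .union_left
        (.union_right (hs.pairwise_disjoint_termVars hjk) (hdj j k))
        (.union_right (hdj k j).symm (ht.pairwise_disjoint_termVars hjk))

/-! ### Variants of rules -/

theorem occ_relabel (e : Equiv.Perm V) (x : V) (t : L.Term V) :
    occ x (t.relabel e) = occ (e.symm x) t := by
  induction t with
  | var y => classical exact if_congr e.eq_symm_apply.symm rfl rfl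
  | func f ts ih => simp only [Term.relabel, occ, ih]

theorem LinearTerm.relabel {t : L.Term V} (h : LinearTerm t) (e : Equiv.Perm V) :
    LinearTerm (t.relabel e) := fun x => (occ_relabel e x t).trans_le (h _)

namespace Rule

theorem finite_vars (ρ : Rule L V) : ρ.vars.Finite :=
  (finite_termVars ρ.lhs).union (finite_termVars ρ.rhs)

theorem vars_rename (e : Equiv.Perm V) (ρ : Rule L V) : (ρ.rename e).vars = e '' ρ.vars := by
  ext x
  simp [vars, rename, occ_relabel, e.image_eq_preimage_symm]

theorem rename_one (ρ : Rule L V) : ρ.rename 1 = ρ := by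
  obtain ⟨l, r⟩ := ρ
  exact congrArg₂ Rule.mk (Term.relabel_id l) (Term.relabel_id r)

end Rule

theorem exists_perm_disjoint_image {α : Type*} [Infinite α] {A B : Set α} (hA : A.Finite)
    (hB : B.Finite) : ∃ e : Equiv.Perm α, Disjoint (e '' A) B := by
  obtain ⟨T, hTB, hT⟩ := hB.infinite_compl.exists_subset_card_eq hA.toFinset.card
  obtain ⟨e, he⟩ := Equiv.Perm.exists_map_finset_eq hA.toFinset T hT.symm
  refine ⟨e, disjoint_left.2 ?_⟩
  rintro _ ⟨x, hx, rfl⟩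
  exact hTB (he ▸ Finset.mem_map_of_mem e.toEmbedding (hA.mem_toFinset.2 hx))

theorem exists_rename_disjoint_joint_subst [Infinite V] (ρ₁ ρ₂ : Rule L V)
    (σ₁ σ₂ : V → L.Term V) :
    ∃ (e : Equiv.Perm V) (τ : V → L.Term V), Disjoint (ρ₁.rename e).vars ρ₂.vars ∧
      EqOn (τ ∘ e) σ₁ ρ₁.vars ∧ EqOn τ σ₂ ρ₂.vars := by
  classical
  obtain ⟨e, he⟩ := exists_perm_disjoint_image ρ₁.finite_vars ρ₂.finite_vars
  refine ⟨e, ρ₂.vars.piecewise σ₂ (σ₁ ∘ e.symm), ρ₁.vars_rename e ▸ he, fun x hx => ?_,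
    piecewise_eqOn _ _ _⟩
  have hex : e x ∉ ρ₂.vars := disjoint_left.1 he (mem_image_of_mem e hx)
  simp [piecewise_eq_of_notMem _ _ _ hex]

/-! ### Critical peaks -/

theorem exists_criticalOverlap [Infinite V] {R : TRS L V} {ρ₁ ρ₂ : R} (h₁ : LinearTerm ρ₁.1.lhs)
    (h₂ : LinearTerm ρ₂.1.lhs) {q : List ℕ} (hq : IsFunPos ρ₂.1.lhs q) {σ₁ σ₂ : V → L.Term V}
    (h : subtermAt (ρ₂.1.lhs.subst σ₂) q = some (ρ₁.1.lhs.subst σ₁)) :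
    ∃ (o : CriticalOverlap R) (δ : V → L.Term V), o.rule₁ = ρ₁ ∧ o.rule₂ = ρ₂ ∧ o.pos = q ∧
      EqOn (fun x => (o.inner.subst x).subst δ) σ₁ ρ₁.1.vars ∧
      EqOn (fun x => (o.outer.subst x).subst δ) σ₂ ρ₂.1.vars := by
  obtain ⟨e, τ, hd, hτ₁, hτ₂⟩ := exists_rename_disjoint_joint_subst ρ₁.1 ρ₂.1 σ₁ σ₂
  obtain ⟨s, hs, -⟩ := id hq
  have hunif : (ρ₁.1.rename e).lhs.subst τ = s.subst τ := by
    have hsτ : subtermAt (ρ₂.1.lhs.subst τ) q = some (s.subst τ) := subtermAt_subst τ hs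
    rw [subst_congr (hτ₂.mono subset_union_left), h, Option.some.injEq] at hsτ
    rw [← hsτ, ← subst_congr (hτ₁.mono subset_union_left)]
    exact relabel_subst _ _ _
  obtain ⟨μ, hμ⟩ := (h₁.relabel e).exists_isIdempotentMGU (h₂.subtermAt hs)
    (hd.mono subset_union_left ((termVars_subset_of_subtermAt hs).trans subset_union_left)) hunif
  let o : CriticalOverlap R :=
    { rule₁ := ρ₁, rule₂ := ρ₂, ren₁ := e, ren₂ := 1, pos := q, mgu := μ
      apart := by rwa [Rule.rename_one]
      funPos := by rwa [Rule.rename_one]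
      isMGU := by
        rw [Rule.rename_one, hs]
        rintro _ ⟨⟩
        exact hμ.isMGU }
  exact ⟨o, τ, rfl, rfl, rfl, fun x hx => (hμ.2 τ hunif (e x)).trans (hτ₁ hx),
    fun x hx => (hμ.2 τ hunif x).trans (hτ₂ hx)⟩

/-- Steps that differ at most in the values of their substitutions on variables that do not occur in
the applied rule. -/
structure Step.Similar {R : TRS L V} (a b : Step R) : Prop where
  source : a.source = b.source
  target : a.target = b.target
  pos : a.pos = b.pos
  rule : a.rule = b.rule

theorem Step.Similar.of_eqOn {R : TRS L V} {a b : Step R} (hs : a.source = b.source)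
    (hp : a.pos = b.pos) (hρ : a.rule = b.rule) (hσ : EqOn a.subst b.subst b.rule.1.vars) :
    a.Similar b := by
  refine ⟨hs, ?_, hp, hρ⟩
  rw [a.target_eq, b.target_eq, hs, hp, hρ, subst_congr (hσ.mono subset_union_right)]

theorem IsLocalPeak.exists_criticalOverlap [Infinite V] {R : TRS L V} {a b : Step R}
    (h : IsLocalPeak a b) (ha : LinearTerm a.rule.1.lhs) (hb : LinearTerm b.rule.1.lhs)
    {q : List ℕ} (hq : a.pos = b.pos ++ q) (hfun : IsFunPos b.rule.1.lhs q) :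
    ∃ (o : CriticalOverlap R) (C : Context L V) (δ : V → L.Term V),
      (o.inner.inst C δ).Similar a ∧ (o.outer.inst C δ).Similar b := by
  have hab := a.source_at
  rw [h, hq, subtermAt_append b.source_at] at hab
  obtain ⟨o, δ, h₁, h₂, hpos, hσ₁, hσ₂⟩ := Rewriting.exists_criticalOverlap ha hb hfun hab
  obtain ⟨C, hC⟩ := b.exists_eq_ofContext
  have hbp : b.pos = C.holePos := congrArg Step.pos hC
  have hsource : C.fill (o.outer.source.subst δ) = b.source := by
    have houter : o.outer.source.subst δ = b.rule.1.lhs.subst b.subst := by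
      have hrelabel : o.outer.source = o.rule₂.1.lhs.subst o.outer.subst := relabel_subst _ _ _
      rw [hrelabel, subst_subst, h₂, subst_congr (hσ₂.mono subset_union_left)]
    rw [houter]
    exact (congrArg Step.source hC).symm
  refine ⟨o, C, δ, .of_eqOn (hsource.trans h.symm) ?_ h₁ hσ₁, .of_eqOn hsource ?_ h₂ hσ₂⟩
  · rw [hq, hbp, ← hpos]
    rfl
  · rw [hbp]
    exact List.append_nil _

/-! ### Confluence -/

section Confluence

variable {R : TRS L V} {Λ : Type*} {ℓ : DirStep R → Λ}

theorem Compatible.extLocDecreasing_of_prefix [Infinite V] {gt ge : Λ → Λ → Prop}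
    (hℓ : Compatible ℓ gt ge) (hsim : ∀ a b : Step R, a.Similar b → ℓ a.fwd = ℓ b.fwd)
    (hlin : ∀ ρ ∈ R, LinearTerm ρ.lhs) (hcp : CriticalPeaksDecreasing ℓ gt ge)
    {a b : Step R} (h : IsLocalPeak a b) (hpos : b.pos <+: a.pos) :
    ExtLocDecreasing ℓ gt ge a b := by
  obtain ⟨q, hq⟩ := hpos
  by_cases hfun : IsFunPos b.rule.1.lhs q
  · obtain ⟨o, C, δ, hinner, houter⟩ :=
      h.exists_criticalOverlap (hlin _ a.rule.2) (hlin _ b.rule.2) hq.symm hfun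
    have hbwd := hsim _ _ hinner
    rw [hℓ.labeling.symm, hℓ.labeling.symm] at hbwd
    exact ((hcp o).inst hℓ.labeling C δ).congr hinner.target houter.target hbwd
      (hsim _ _ houter)
  · exact hℓ.variable_peak a b ⟨h, q, hq.symm, hfun⟩

variable [Preorder Λ]

/-- The rewrite steps with a label of at most `n`, as a relation on terms. Bounding the labels
instead of fixing them turns the comparisons `≥` in local diagrams into mere membership. -/
def StepUpTo (ℓ : DirStep R → Λ) (n : Λ) (s t : L.Term V) : Prop :=
  ∃ a : Step R, a.source = s ∧ a.target = t ∧ ℓ a.fwd ≤ n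

theorem anyStep_stepUpTo (ℓ : DirStep R → Λ) : AnyStep (StepUpTo ℓ) = Rewrites R := by
  ext s t
  rw [rewrites_iff_exists_step]
  exact ⟨fun ⟨_, a, hs, ht, _⟩ => ⟨a, hs, ht⟩, fun ⟨a, hs, ht⟩ => ⟨_, a, hs, ht, le_rfl⟩⟩

section Conversions

variable {s t : L.Term V} {c : List (DirStep R)}

theorem IsConversion.conv (h : IsConversion s c t) (hsymm : ∀ a : Step R, ℓ a.fwd = ℓ a.bwd)
    {S : Set Λ} (hc : ∀ d ∈ c, ℓ d ∈ S) : Conv (StepUpTo ℓ) S s t := by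
  induction c generalizing s with
  | nil => exact h ▸ .refl s
  | cons d c ih =>
    obtain ⟨rfl, h⟩ := h
    obtain ⟨hd, hc⟩ := List.forall_mem_cons.1 hc
    refine .trans ?_ (ih h hc)
    obtain ⟨a, _ | _⟩ := d
    · exact (Conv.of_step hd ⟨a, rfl, rfl, (hsymm a).le⟩).symm
    · exact .of_step hd ⟨a, rfl, rfl, le_rfl⟩

theorem IsOptForward.reflGen (h : IsOptForward s c t) {n : Λ} (hc : ∀ d ∈ c, ℓ d ≤ n) :
    Relation.ReflGen (StepUpTo ℓ n) s t := by
  obtain ⟨h, hlen, hdir⟩ := h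
  match c with
  | [] => exact h ▸ .refl
  | [⟨a, fwd⟩] =>
    obtain rfl : fwd = true := hdir _ (List.mem_singleton_self _)
    obtain ⟨rfl, rfl⟩ := h
    exact .single ⟨a, rfl, rfl, hc _ (List.mem_singleton_self _)⟩

theorem IsOptBackward.reflGen (h : IsOptBackward s c t)
    (hsymm : ∀ a : Step R, ℓ a.fwd = ℓ a.bwd) {n : Λ} (hc : ∀ d ∈ c, ℓ d ≤ n) :
    Relation.ReflGen (StepUpTo ℓ n) t s := by
  obtain ⟨h, hlen, hdir⟩ := h
  match c with
  | [] => exact h ▸ .refl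
  | [⟨a, fwd⟩] =>
    obtain rfl : fwd = false := hdir _ (List.mem_singleton_self _)
    obtain ⟨rfl, rfl⟩ := h
    exact .single ⟨a, rfl, rfl, (hsymm a).trans_le (hc _ (List.mem_singleton_self _))⟩

end Conversions

theorem ExtLocDecreasing.decreasingJoin {a b : Step R}
    (h : ExtLocDecreasing ℓ (· > ·) (· ≥ ·) a b) (hsymm : ∀ a : Step R, ℓ a.fwd = ℓ a.bwd)
    {m n : Λ} (ha : ℓ a.fwd ≤ m) (hb : ℓ b.fwd ≤ n) :
    DecreasingJoin (StepUpTo ℓ) m n a.target b.target := by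
  obtain ⟨t', t'', u'', u', c₁, c₂, c₃, c₄, c₅, h₁, h₂, h₃, h₄, h₅, l⟩ := h
  simp only [labels_subset_below_singleton, labels_subset_below_pair, ← hsymm a] at l
  obtain ⟨l₁, l₂, l₃, l₄, l₅⟩ := l
  exact ⟨t', t'', u'', u', h₁.conv hsymm fun d hd => (l₁ d hd).trans_le ha,
    h₂.reflGen fun d hd => (l₂ d hd).trans hb,
    h₃.conv hsymm fun d hd => (l₃ d hd).imp ha.trans_lt' hb.trans_lt',
    h₄.reflGen hsymm fun d hd => (l₄ d hd).trans ha,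
    h₅.conv hsymm fun d hd => (l₅ d hd).trans_le hb⟩

theorem Compatible.confluent [Infinite V] [WellFoundedLT Λ]
    (hℓ : Compatible ℓ (· > ·) (· ≥ ·)) (hsim : ∀ a b : Step R, a.Similar b → ℓ a.fwd = ℓ b.fwd)
    (hlin : ∀ ρ ∈ R, LinearTerm ρ.lhs) (hcp : CriticalPeaksDecreasing ℓ (· > ·) (· ≥ ·)) :
    Confluent R := by
  intro s t u hst hsu
  rw [← anyStep_stepUpTo ℓ] at hst hsu ⊢
  refine confluent_of_decreasingJoin ?_ hst hsu
  rintro m n _ _ _ ⟨a, rfl, rfl, ha⟩ ⟨b, h, rfl, hb⟩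
  have hab : IsLocalPeak a b := h.symm
  by_cases hba : b.pos <+: a.pos
  · exact (hℓ.extLocDecreasing_of_prefix hsim hlin hcp hab hba).decreasingJoin
      hℓ.labeling.symm ha hb
  by_cases hab' : a.pos <+: b.pos
  · exact ((hℓ.extLocDecreasing_of_prefix hsim hlin hcp h hab').decreasingJoin
      hℓ.labeling.symm hb ha).symm
  · exact (hℓ.parallel a b ⟨hab, hab', hba⟩).decreasingJoin hℓ.labeling.symm ha hb

end Confluence

end Rewriting

theorem mainTheorem6_general {L : FirstOrder.Language} {V : Type*} [Infinite V] {Λ : Type*}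
    [Preorder Λ] [WellFoundedLT Λ] (R : Rewriting.TRS L V) (i : R → Λ) :
    Rewriting.IsLabeling (Rewriting.generalRuleLabeling i) (· > ·) (· ≥ ·) ∧
    (Rewriting.LinearTRS R →
      Rewriting.Compatible (Rewriting.generalRuleLabeling i) (· > ·) (· ≥ ·)) ∧
    (Rewriting.LinearTRS R →
      Rewriting.CriticalPeaksDecreasing (Rewriting.generalRuleLabeling i) (· > ·) (· ≥ ·) →
      Rewriting.Confluent R) :=
  ⟨Rewriting.isLabeling_generalRuleLabeling i _ _, fun hR => hR.compatible_generalRuleLabeling i,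
    fun hR => (hR.compatible_generalRuleLabeling i).confluent
      (fun _ _ h => congrArg i h.rule) fun ρ hρ => (hR ρ hρ).1⟩

theorem mainTheorem6 {L : FirstOrder.Language} {V : Type*} [Infinite V]
    (R : Rewriting.TRS L V) (i : R → ℕ) :
    Rewriting.IsLabeling (Rewriting.ruleLabeling i) (· > ·) (· ≥ ·) ∧
    (Rewriting.LinearTRS R →
      Rewriting.Compatible (Rewriting.ruleLabeling i) (· > ·) (· ≥ ·)) ∧
    (Rewriting.LinearTRS R →
      Rewriting.CriticalPeaksDecreasing (Rewriting.ruleLabeling i) (· > ·) (· ≥ ·) →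
      Rewriting.Confluent R) :=
  mainTheorem6_general R i
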